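/- A paratopological group is a group $G$ with a topology (not assumed to satisfy any separation axiom unless stated) for which the multiplication $G\times G\to G$ is continuous. Write $e$ for its unit. Let $\tau_\flat$ be the strongest group topology on $G$ that is weaker than the topology of $G$, and let $G^\flat=(G,\tau_\flat)$. The group $G$ is called $\flat$-separated if $G^\flat$ is Hausdorff, and $\flat$-regular if every neighborhood of $e$ in $G$ contains a neighborhood of $e$ in $G$ that is closed in $G^\flat$. For $U\subset G$ and an integer $n\ge 1$ let $(\pm U)^n=UU^{-1}U\cdots U^{(-1)^{n-1}}$ ($n$ factors). The oscillation number $\mathrm{osc}(G)\in\mathbb N\cup\{\omega,\infty\}$, where $n<\omega<\infty$ for every positive integer $n$, is the smallest positive integer $n$ such that $(\pm U)^n$ is a neighborhood of $e$ in $G^\flat$ for every neighborhood $U$ of $e$ in $G$, if such an $n$ exists. Otherwise $\mathrm{osc}(G)=\omega$ if for every neighborhood $U$ of $e$ in $G$ there is a positive integer $n$ such that $(\pm U)^n$ is a neighborhood of $e$ in $G^\flat$, and $\mathrm{osc}(G)=\infty$ if this fails too. The group $G$ is called $n$-oscillating if $\mathrm{osc}(G)\le n$. **Corollary.** Let $G$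 be a Hausdorff paratopological group that satisfies at least one of the following conditions: 1. $G$ is saturated, that is, for every neighborhood $U$ of $e$ in $G$ the set $U^{-1}$ has nonempty interior in $G$; 2. $G$ is a paratopological LSIN-group, that is, for every neighborhood $U$ of $e$ in $G$ there is a neighborhood $W$ of $e$ in $G$ such that $g^{-1}Wg\subset U$ for every $g\in W$; 3. $G$ is absolutely $2$-oscillating, that is, every paratopological group algebraically isomorphic to $G$ is $2$-oscillating; 4. $G$ is collapsing, that is, there are positive integers $n,m$ such that $|A^m|<|A|^m$ for every $n$-element subset $A$ of $G$, where $A^m=A\cdots A$ ($m$ factors). Then $G$ is $\flat$-separated. If, moreover, $G$ is regular, then $G$ is also $\flat$-regular. -/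

import Mathlib

open scoped Pointwise Topology

universe u

namespace Paratop

/-- The sets `(±U)^n`: `(±U)^0 = {e}` and `(±U)^(n+1) = U * (∓U)^n`, where `(∓U)^n` is
`(±U⁻¹)^n`; thus `(±U)^n = U * U⁻¹ * U * ⋯` with `n` factors. -/
def alternatingPow {G : Type u} [Group G] : Set G → ℕ → Set G
  | _, 0 => {1}
  | U, n + 1 => U * alternatingPow U⁻¹ n

/-- The topology of the group reflexion `G^♭`: the strongest group topology on `G` weaker than
the topology of `G`. (In Mathlib's order on topologies, `t ≤ s` means that `t` is stronger.) -/
noncomputable def flatTopology (G : Type u) [Group G] [τ : TopologicalSpace G] :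
    GroupTopology G :=
  sInf {t : GroupTopology G | τ ≤ t.toTopologicalSpace}

/-- The topology `flatTopology G` is itself weaker than the topology of `G`, and it is stronger
than any other group topology with this property. -/
theorem isLeast_flatTopology (G : Type u) [Group G] [τ : TopologicalSpace G] :
    IsLeast {t : GroupTopology G | τ ≤ t.toTopologicalSpace} (flatTopology G) := by
  refine ⟨?_, fun t ht => sInf_le ht⟩
  simp only [Set.mem_ofPred_eq, flatTopology, GroupTopology.toTopologicalSpace_sInf]
  refine le_sInf ?_
  rintro _ ⟨t, ht, rfl⟩
  exact ht

/-- `G` is ♭-separated: the group reflexion `G^♭` is Hausdorff. -/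
def FlatSeparated (G : Type u) [Group G] [TopologicalSpace G] : Prop :=
  @T2Space G (flatTopology G).toTopologicalSpace

/-- `G` is ♭-regular: each neighborhood of the unit contains a neighborhood of the unit (in `G`)
that is closed in `G^♭`. -/
def FlatRegular (G : Type u) [Group G] [TopologicalSpace G] : Prop :=
  ∀ U ∈ 𝓝 (1 : G), ∃ V ∈ 𝓝 (1 : G), V ⊆ U ∧ IsClosed[(flatTopology G).toTopologicalSpace] V

/-- For every neighborhood `U` of the unit in `G`, the set `(±U)^n` is a neighborhood of the unit
in `G^♭`. -/
def OscillationBound (G : Type u) [Group G] [TopologicalSpace G] (n : ℕ) : Prop :=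
  ∀ U ∈ 𝓝 (1 : G), alternatingPow U n ∈ @nhds G (flatTopology G).toTopologicalSpace 1

/-- `G` has finite oscillation. -/
def FiniteOscillation (G : Type u) [Group G] [TopologicalSpace G] : Prop :=
  ∃ n : ℕ, 0 < n ∧ OscillationBound G n

/-- `G` has countable oscillation. -/
def CountableOscillation (G : Type u) [Group G] [TopologicalSpace G] : Prop :=
  ∀ U ∈ 𝓝 (1 : G), ∃ n : ℕ, 0 < n ∧
    alternatingPow U n ∈ @nhds G (flatTopology G).toTopologicalSpace 1

open Classical in
/-- The oscillation number `osc(G)`, with values in `ℕ ∪ {ω, ∞}`, where `n < ω < ∞` for all `n`: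
the value `ω` is `((⊤ : ℕ∞) : WithTop ℕ∞)` and the value `∞` is `(⊤ : WithTop ℕ∞)`. -/
noncomputable def osc (G : Type u) [Group G] [TopologicalSpace G] : WithTop ℕ∞ :=
  if FiniteOscillation G then
    ((sInf {n : ℕ | 0 < n ∧ OscillationBound G n} : ℕ) : WithTop ℕ∞)
  else if CountableOscillation G then ((⊤ : ℕ∞) : WithTop ℕ∞)
  else ⊤

/-- `G` is `n`-oscillating. -/
def Oscillating (n : ℕ) (G : Type u) [Group G] [TopologicalSpace G] : Prop :=
  osc G ≤ (n : WithTop ℕ∞)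

/-- The abstract group `G` is absolutely `n`-oscillating: every paratopological group that is
algebraically isomorphic to `G` is `n`-oscillating. -/
def AbsolutelyOscillating (n : ℕ) (G : Type u) [Group G] : Prop :=
  ∀ (H : Type u) [Group H] [TopologicalSpace H] [ContinuousMul H],
    Nonempty (G ≃* H) → Oscillating n H

/-- `G` is saturated. -/
def Saturated (G : Type u) [Group G] [TopologicalSpace G] : Prop :=
  ∀ U ∈ 𝓝 (1 : G), (interior U⁻¹).Nonempty

/-- `G` is a paratopological LSIN-group. -/
def IsLSIN (G : Type u) [Group G] [TopologicalSpace G] : Prop :=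
  ∀ U ∈ 𝓝 (1 : G), ∃ W ∈ 𝓝 (1 : G), ∀ g ∈ W, ∀ w ∈ W, g⁻¹ * w * g ∈ U

/-- The abstract group `G` is collapsing: for some positive integers `n`, `m`, every `n`-element
subset `A` of `G` satisfies `|A^m| < |A|^m`, where `A^m = A * ⋯ * A` with `m` factors. -/
def Collapsing (G : Type u) [Group G] : Prop :=
  ∃ n m : ℕ, 0 < n ∧ 0 < m ∧
    ∀ A : Finset G, A.card = n → ((A : Set G) ^ m).ncard < A.card ^ m

end Paratop

/-!
Everything follows from one property, `HalfOscillating`: for each neighborhood `U` of the unit,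
`U * U⁻¹` is a neighborhood of the unit in the group reflexion `G^♭`.

*Consequences.* If `G` is Hausdorff and `x ≠ 1`, some neighborhood `U` of the unit is disjoint from
`x * U`, which says that `x ∉ U * U⁻¹`; so `G^♭` is Hausdorff (`HalfOscillating.flatSeparated`).
If a point `x` lies in the `♭`-closure of `V`, then `x * W` meets `V * V` for every neighborhood
`W ⊆ V` of the unit, so the `♭`-closure of `V` lies in the original closure of `V * V`. When `G` is
regular, the latter can be made as small as desired (`HalfOscillating.flatRegular`).

*Sufficient condition.* If each `U` admits a `V` with `V⁻¹ * V ⊆ U * U⁻¹`, then the sets `U * U⁻¹`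
form a neighborhood base at the unit of a group topology, which is weaker than the given topology
and hence weaker than that of `G^♭` (`halfOscillating_of_inv_mul_subset`).

*The four hypotheses.* For a saturated group, translate an open subset of `U⁻¹` to the unit. For an
LSIN-group, write `v⁻¹ * w = (v⁻¹ * w * v) * v⁻¹`. An absolutely `2`-oscillating group has the
property by definition. In a group without the sufficient condition, there are, arbitrarily close
to the unit, elements `a`, `b` with `a * U` and `b * U` disjoint. The elements `a ^ i * b`, `i < n`,
form a prefix code in `a` and `b`, so all their products of length `m` are distinct; this is
impossible in a collapsing group (`Collapsing.exists_inv_mul_subset`).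
-/

namespace Paratop

open Filter

/-- For every neighborhood `U` of the unit in `G`, the set `U * U⁻¹` is a neighborhood of the unit
in `G^♭`. -/
def HalfOscillating (G : Type u) [Group G] [TopologicalSpace G] : Prop :=
  ∀ U ∈ 𝓝 (1 : G), U * U⁻¹ ∈ @nhds G (flatTopology G).toTopologicalSpace 1

variable {G : Type u} [Group G] [TopologicalSpace G]

/-! ### Consequences for the group reflexion -/

theorem HalfOscillating.flatSeparated [ContinuousMul G] [T2Space G] (h : HalfOscillating G) :
    FlatSeparated G := by
  refine @IsTopologicalGroup.t2Space_of_one_sep G (flatTopology G).toTopologicalSpace _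
    (flatTopology G).toIsTopologicalGroup fun x hx => ?_
  obtain ⟨A, B, hA, hB, hAB⟩ := t2_separation_nhds hx
  have hA' : (fun y => x * y) ⁻¹' A ∈ 𝓝 (1 : G) :=
    (continuous_const_mul x).continuousAt (by simpa using hA)
  refine ⟨_, h _ (inter_mem hA' hB), ?_⟩
  rintro ⟨u, hu, v, hv, huv⟩
  have hv' : x * v⁻¹ ∈ A ∧ v⁻¹ ∈ B := hv
  have hxu : x * v⁻¹ = u := by simp only at huv; rw [← huv]; group
  exact Set.disjoint_left.1 hAB hv'.1 (hxu ▸ hu.2)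

theorem exists_mul_mem_of_mem_closure {H : Type*} [Group H] [TopologicalSpace H]
    [IsTopologicalGroup H] {V N : Set H} {x : H} (hx : x ∈ closure V) (hN : N ∈ 𝓝 (1 : H)) :
    ∃ y ∈ N, x * y ∈ V := by
  have hxN : (fun y => x⁻¹ * y) ⁻¹' N ∈ 𝓝 x :=
    (continuous_const_mul x⁻¹).continuousAt (by simpa using hN)
  obtain ⟨v, hv, hvV⟩ := mem_closure_iff_nhds.1 hx _ hxN
  exact ⟨x⁻¹ * v, hv, by simpa using hvV⟩

theorem HalfOscillating.flatRegular [ContinuousMul G] [RegularSpace G] (h : HalfOscillating G) :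
    FlatRegular G := by
  intro U hU
  obtain ⟨C, hC, hCc, hCU⟩ := exists_mem_nhds_isClosed_subset hU
  obtain ⟨V, hV, hVC⟩ := exists_nhds_one_split hC
  refine ⟨@closure G (flatTopology G).toTopologicalSpace V,
    mem_of_superset hV (@subset_closure G (flatTopology G).toTopologicalSpace V), ?_,
    @isClosed_closure G (flatTopology G).toTopologicalSpace V⟩
  refine fun x hx => hCU (hCc.closure_subset (mem_closure_iff_nhds.2 fun N hN => ?_))
  have hW : (fun y => x * y) ⁻¹' N ∈ 𝓝 (1 : G) :=
    (continuous_const_mul x).continuousAt (by simpa using hN)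
  have hflat := h _ (inter_mem hW hV)
  obtain ⟨_, ⟨w₁, hw₁, w₂, hw₂, rfl⟩, hv⟩ := @exists_mul_mem_of_mem_closure G _
    (flatTopology G).toTopologicalSpace (flatTopology G).toIsTopologicalGroup _ _ _ hx hflat
  refine ⟨x * w₁, hw₁.1, ?_⟩
  have : x * w₁ = x * (w₁ * w₂) * w₂⁻¹ := by group
  rw [this]
  exact hVC _ hv _ hw₂.2

/-! ### A sufficient condition -/

theorem halfOscillating_of_inv_mul_subset [ContinuousMul G]
    (h : ∀ U ∈ 𝓝 (1 : G), ∃ V ∈ 𝓝 (1 : G), V⁻¹ * V ⊆ U * U⁻¹) : HalfOscillating G := by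
  let B : GroupFilterBasis G :=
    { sets := {S | ∃ U ∈ 𝓝 (1 : G), S = U * U⁻¹}
      nonempty := ⟨_, Set.univ, univ_mem, rfl⟩
      inter_sets := by
        rintro _ _ ⟨U, hU, rfl⟩ ⟨V, hV, rfl⟩
        refine ⟨_, ⟨U ∩ V, inter_mem hU hV, rfl⟩, Set.subset_inter ?_ ?_⟩
        · exact Set.mul_subset_mul Set.inter_subset_left
            (Set.inv_subset_inv.2 Set.inter_subset_left)
        · exact Set.mul_subset_mul Set.inter_subset_right
            (Set.inv_subset_inv.2 Set.inter_subset_right)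
      one' := by
        rintro _ ⟨U, hU, rfl⟩
        exact ⟨1, mem_of_mem_nhds hU, 1, by simpa using mem_of_mem_nhds hU, mul_one 1⟩
      mul' := by
        rintro _ ⟨U, hU, rfl⟩
        obtain ⟨U', hU', hUU⟩ := exists_nhds_one_split hU
        obtain ⟨V, hV, hVU⟩ := h U' hU'
        refine ⟨_, ⟨V ∩ U', inter_mem hV hU', rfl⟩, ?_⟩
        -- `V V⁻¹ V V⁻¹ ⊆ V U' U'⁻¹ V⁻¹ ⊆ U U⁻¹`
        rintro _ ⟨_, ⟨a, ha, b, hb, rfl⟩, _, ⟨c, hc, d, hd, rfl⟩, rfl⟩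
        obtain ⟨p, hp, q, hq, hpq⟩ := hVU ⟨b, hb.1, c, hc.1, rfl⟩
        refine ⟨a * p, hUU a ha.2 p hp, q * d, ?_, ?_⟩
        · rw [Set.mem_inv, mul_inv_rev]
          exact hUU _ hd.2 _ hq
        · simp only at hpq ⊢
          rw [mul_assoc a p, ← mul_assoc p, hpq]; group
      inv' := by
        rintro _ ⟨U, hU, rfl⟩
        refine ⟨_, ⟨U, hU, rfl⟩, ?_⟩
        rintro _ ⟨a, ha, b, hb, rfl⟩
        exact ⟨b⁻¹, hb, a⁻¹, by simpa using ha, by simp⟩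
      conj' := by
        rintro g _ ⟨U, hU, rfl⟩
        have hg : (fun y => g * y * g⁻¹) ⁻¹' U ∈ 𝓝 (1 : G) := by
          have hc : Continuous fun y : G => g * y * g⁻¹ := by fun_prop
          exact hc.continuousAt (by simpa using hU)
        refine ⟨_, ⟨_, hg, rfl⟩, ?_⟩
        rintro _ ⟨a, ha, b, hb, rfl⟩
        refine ⟨g * a * g⁻¹, ha, g * b * g⁻¹, ?_, by simp only; group⟩
        rw [Set.mem_inv, mul_inv_rev, mul_inv_rev, inv_inv, ← mul_assoc]
        exact hb }
  have hB : ∀ U ∈ 𝓝 (1 : G), U * U⁻¹ ∈ @nhds G B.topology 1 := fun U hU =>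
    (B.nhds_one_hasBasis).mem_iff.2 ⟨_, ⟨U, hU, rfl⟩, subset_rfl⟩
  let t : GroupTopology G :=
    { toTopologicalSpace := B.topology
      toIsTopologicalGroup := B.isTopologicalGroup }
  have ht : ‹TopologicalSpace G› ≤ t.toTopologicalSpace := by
    refine (le_iff_nhds _ _).2 fun x S hS => ?_
    obtain ⟨_, ⟨U, hU, rfl⟩, hUS⟩ := (B.nhds_hasBasis x).mem_iff.1 hS
    have hx : (fun y => x⁻¹ * y) ⁻¹' U ∈ 𝓝 x :=
      (continuous_const_mul x⁻¹).continuousAt (by simpa using hU)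
    refine mem_of_superset hx fun y hy => hUS ⟨x⁻¹ * y, ⟨x⁻¹ * y, hy, 1, ?_, mul_one _⟩, ?_⟩
    · simpa using mem_of_mem_nhds hU
    · simp
  have hle : (flatTopology G).toTopologicalSpace ≤ t.toTopologicalSpace :=
    (isLeast_flatTopology G).2 ht
  exact fun U hU => (le_iff_nhds _ _).1 hle 1 (hB U hU)

/-! ### Saturated, LSIN and 2-oscillating groups -/

theorem Saturated.exists_inv_mul_subset [ContinuousMul G] (h : Saturated G) :
    ∀ U ∈ 𝓝 (1 : G), ∃ V ∈ 𝓝 (1 : G), V⁻¹ * V ⊆ U * U⁻¹ := by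
  intro U hU
  obtain ⟨x, hx⟩ := h U hU
  refine ⟨(fun y => x * y) ⁻¹' U⁻¹, (continuous_const_mul x).continuousAt
    (by simpa using mem_interior_iff_mem_nhds.1 hx), ?_⟩
  rintro _ ⟨v, hv, w, hw, rfl⟩
  refine ⟨v * x⁻¹, ?_, x * w, hw, by simp⟩
  simpa using hv

theorem IsLSIN.exists_inv_mul_subset (h : IsLSIN G) :
    ∀ U ∈ 𝓝 (1 : G), ∃ V ∈ 𝓝 (1 : G), V⁻¹ * V ⊆ U * U⁻¹ := by
  intro U hU
  obtain ⟨W, hW, hWU⟩ := h U hU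
  refine ⟨W ∩ U, inter_mem hW hU, ?_⟩
  rintro _ ⟨v, hv, w, hw, rfl⟩
  exact ⟨v * w * v⁻¹, by simpa using hWU v⁻¹ hv.1 w hw.1, v, hv.2, by simp⟩

theorem Oscillating.exists_oscillationBound {n : ℕ} (h : Oscillating n G) :
    ∃ k : ℕ, 0 < k ∧ k ≤ n ∧ OscillationBound G k := by
  unfold Oscillating osc at h
  split_ifs at h with hf hc
  · have hmem := Nat.sInf_mem hf
    exact ⟨_, hmem.1, by exact_mod_cast h, hmem.2⟩
  · exact absurd (WithTop.coe_le_coe.1 h) (by simp)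
  · exact absurd h (by simp)

theorem Oscillating.halfOscillating (h : Oscillating 2 G) : HalfOscillating G := by
  obtain ⟨k, hk0, hk2, hk⟩ := h.exists_oscillationBound
  intro U hU
  refine @mem_of_superset _ _ _ _ (hk U hU) ?_
  interval_cases k
  · simp only [alternatingPow, Set.singleton_one, mul_one]
    exact fun x hx => ⟨x, hx, 1, by simpa using mem_of_mem_nhds hU, mul_one x⟩
  · simp [alternatingPow]

/-! ### Collapsing groups -/

theorem exists_nhds_one_list_prod_mem [ContinuousMul G] (N : ℕ) {U : Set G}
    (hU : U ∈ 𝓝 (1 : G)) : ∃ V ∈ 𝓝 (1 : G), ∀ l : List G, l.length ≤ N → (∀ x ∈ l, x ∈ V) →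
      l.prod ∈ U := by
  induction N generalizing U with
  | zero =>
    refine ⟨Set.univ, univ_mem, fun l hl _ => ?_⟩
    rw [List.length_eq_zero_iff.1 (Nat.le_zero.1 hl)]
    simpa using mem_of_mem_nhds hU
  | succ N ih =>
    obtain ⟨W, hW, hWU⟩ := exists_nhds_one_split hU
    obtain ⟨V, hV, hVW⟩ := ih hW
    refine ⟨V ∩ W, inter_mem hV hW, fun l hl hlV => ?_⟩
    cases l with
    | nil => simpa using mem_of_mem_nhds hU
    | cons a l =>
      rw [List.prod_cons]
      exact hWU a (hlV a (by simp)).2 _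
        (hVW l (by simpa using hl) fun x hx => (hlV x (List.mem_cons_of_mem _ hx)).1)

/-- If the sets `x i * W` are pairwise disjoint and `W` contains all short products of the `x i`,
then words in the `x i` of the same length are determined by their products. -/
theorem list_eq_of_prod_map_eq {H ι : Type*} [Group H] {x : ι → H} {W : Set H} {m : ℕ}
    (hx : ∀ i j, ∀ v ∈ W, ∀ w ∈ W, x i * v = x j * w → i = j)
    (hW : ∀ l : List ι, l.length ≤ m → (l.map x).prod ∈ W) :
    ∀ l l' : List ι, l.length = l'.length → l.length ≤ m →
      (l.map x).prod = (l'.map x).prod → l = l'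
  | [], [], _, _, _ => rfl
  | [], _ :: _, h, _, _ => by simp at h
  | _ :: _, [], h, _, _ => by simp at h
  | i :: l, j :: l', h, hm, he => by
    simp only [List.length_cons, Nat.add_right_cancel_iff] at h hm
    simp only [List.map_cons, List.prod_cons] at he
    obtain rfl := hx i j _ (hW l (by omega)) _ (hW l' (by omega)) he
    rw [list_eq_of_prod_map_eq hx hW l l' h (by omega) (mul_left_cancel he)]

theorem Collapsing.exists_inv_mul_subset [ContinuousMul G] (h : Collapsing G) :
    ∀ U ∈ 𝓝 (1 : G), ∃ V ∈ 𝓝 (1 : G), V⁻¹ * V ⊆ U * U⁻¹ := by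
  classical
  obtain ⟨n, m, -, -, hA⟩ := h
  intro U hU
  by_contra! hneg
  obtain ⟨W, hW, hWU⟩ := exists_nhds_one_split hU
  have hWU' : W ⊆ U := fun w hw => by simpa using hWU 1 (mem_of_mem_nhds hW) w hw
  obtain ⟨V₁, hV₁, hV₁W⟩ := exists_nhds_one_list_prod_mem m hW
  obtain ⟨V, hV, hVW⟩ := exists_nhds_one_list_prod_mem n (inter_mem hV₁ hW)
  obtain ⟨_, ⟨a', ha, b, hb, rfl⟩, hab⟩ := Set.not_subset.1 (hneg V hV)
  obtain ⟨a, rfl⟩ : ∃ a, a' = a⁻¹ := ⟨a'⁻¹, by simp⟩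
  rw [Set.mem_inv, inv_inv] at ha
  have hdisj : ∀ u ∈ U, ∀ v ∈ U, a * u ≠ b * v := fun u hu v hv he =>
    hab ⟨u, hu, v⁻¹, by simpa using hv, by
      simp only; rw [mul_inv_eq_iff_eq_mul, mul_assoc, ← he]; group⟩
  have hword : ∀ i < n, a ^ i * b ∈ V₁ ∩ W := fun i hi => by
    have := hVW (List.replicate i a ++ [b]) (by simpa using hi) (by
      intro x hx
      rcases List.mem_append.1 hx with hx | hx
      · rwa [List.eq_of_mem_replicate hx]
      · rwa [List.mem_singleton.1 hx])
    simpa using this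
  -- The code words `a ^ i * b` and `a ^ j * b`, `i < j`, first differ at position `i`.
  have hlt : ∀ i j, i < j → j < n → ∀ v ∈ W, ∀ w ∈ W,
      a ^ i * b * v ≠ a ^ j * b * w := by
    intro i j hij hj v hv w hw he
    obtain ⟨k, rfl⟩ := Nat.exists_eq_add_of_lt hij
    refine hdisj (a ^ k * b * w) (hWU _ (hword k (by omega)).2 w hw) v (hWU' hv) ?_
    refine mul_left_cancel (a := a ^ i) ?_
    rw [← mul_assoc (a ^ i) b, he]
    simp only [pow_add, pow_one, mul_assoc]
    rw [← mul_assoc a (a ^ k), ← mul_assoc (a ^ k) a, (Commute.self_pow a k).eq]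
  let x : Fin n → G := fun i => a ^ (i : ℕ) * b
  have hx : ∀ i j, ∀ v ∈ W, ∀ w ∈ W, x i * v = x j * w → i = j := by
    intro i j v hv w hw he
    rcases lt_trichotomy i j with hij | hij | hij
    · exact absurd he (hlt i j hij j.2 v hv w hw)
    · exact hij
    · exact absurd he.symm (hlt j i hij i.2 w hw v hv)
  have hxW : ∀ l : List (Fin n), l.length ≤ m → (l.map x).prod ∈ W := fun l hl =>
    hV₁W _ (by simpa using hl) fun y hy => by
      obtain ⟨i, -, rfl⟩ := List.mem_map.1 hy
      exact (hword i i.2).1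
  have hxinj : Function.Injective x := fun i j hij =>
    hx i j 1 (mem_of_mem_nhds hW) 1 (mem_of_mem_nhds hW) (by rw [hij])
  have hcard : (Finset.univ.image x).card = n := by
    rw [Finset.card_image_of_injective _ hxinj, Finset.card_fin]
  let p : (Fin m → Fin n) → G := fun s => ((List.ofFn s).map x).prod
  have hp : Function.Injective p := fun s s' hs =>
    List.ofFn_injective (list_eq_of_prod_map_eq hx hxW _ _ (by simp) (by simp) hs)
  have hrange : Set.range p ⊆ ((Finset.univ.image x : Finset G) : Set G) ^ m := by
    rintro _ ⟨s, rfl⟩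
    rw [Set.mem_pow]
    refine ⟨fun i => ⟨x (s i), by simp⟩, ?_⟩
    simp [p, List.map_ofFn, Function.comp_def]
  have hfin : (((Finset.univ.image x : Finset G) : Set G) ^ m).Finite :=
    by
    rw [← Finset.coe_pow]; exact Finset.finite_toSet _
  have hle := Set.ncard_le_ncard hrange hfin
  rw [Set.ncard_range_of_injective hp, Nat.card_fun, Nat.card_fin, Nat.card_fin] at hle
  have hlt' := hA _ hcard
  rw [hcard] at hlt'
  exact absurd hlt' (not_lt.2 hle)

end Paratop

theorem mainTheorem6 (G : Type u) [Group G] [TopologicalSpace G] [ContinuousMul G] [T2Space G]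
    (h : Paratop.Saturated G ∨ Paratop.IsLSIN G ∨ Paratop.AbsolutelyOscillating 2 G ∨
      Paratop.Collapsing G) :
    Paratop.FlatSeparated G ∧ (RegularSpace G → Paratop.FlatRegular G) := by
  have hosc : Paratop.HalfOscillating G := by
    rcases h with h | h | h | h
    · exact Paratop.halfOscillating_of_inv_mul_subset h.exists_inv_mul_subset
    · exact Paratop.halfOscillating_of_inv_mul_subset h.exists_inv_mul_subset
    · exact (h G ⟨MulEquiv.refl G⟩).halfOscillating
    · exact Paratop.halfOscillating_of_inv_mul_subset h.exists_inv_mul_subset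
  exact ⟨hosc.flatSeparated, fun _ => hosc.flatRegular⟩
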